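/- Fix integers $d\ge 0$ and $k>1$. Fix an expert architecture: an expert is a feedforward ReLU network $\mathcal E(\cdot;\theta)=f_L\circ\sigma\circ f_{L-1}\circ\cdots\circ\sigma\circ f_1:\mathbb R^d\to\mathbb R^d$ with $L\ge 1$ affine layers $f_\ell$ of fixed widths, $\sigma$ the componentwise ReLU, and $\theta$ the collection of all weight matrices and biases of the layers. For $z\in\mathbb R^n$ with $n\ge k$, let $\mathrm{Top}\text{-}k(z)\subseteq\{1,\dots,n\}$ be the set of indices of the $k$ largest components of $z$, smaller indices being selected first in the event of ties. For $\phi=(W_i,b_i,\theta_i)_{i=1}^n$ with $W_i\in\mathbb R^d$, $b_i\in\mathbb R$ and expert parameters $\theta_i$, put $s_i(x)=W_i x+b_i$ (where $W_i x$ is the dot product), $T(x)=\mathrm{Top}\text{-}k\big((s_j(x))_{j=1}^n\big)$, and define the sparse mixture of experts $$\mathcal S(x;\phi)=\sum_{i\in T(x)}\frac{e^{s_i(x)}}{\sum_{j\in T(x)}e^{s_j(x)}}\,\mathcal E(x;\theta_i),\qquad x\in\mathbb R^d.$$ Let $\Omega=\Omega(\{W_i,b_i\}_{i=1}^n)$ be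 the set of $x\in\mathbb R^d$ at which $W_1x+b_1,\dots,W_nx+b_n$ are pairwise distinct. Two functions on $\mathbb R^d$ are called strongly distinct if the set of points where they differ is dense in $\mathbb R^d$. **Theorem 4.2.** Let $n,n'\ge k$ and let $\phi=(W_i,b_i,\theta_i)_{i=1}^n$ and $\phi'=(W_i',b_i',\theta_i')_{i=1}^{n'}$ define the same function, $\mathcal S(x;\phi)=\mathcal S(x;\phi')$ for all $x\in\mathbb R^d$. Assume that: 1. the functions $\mathcal E(\cdot;\theta_1),\dots,\mathcal E(\cdot;\theta_n)$ are pairwise strongly distinct, and so are $\mathcal E(\cdot;\theta_1'),\dots,\mathcal E(\cdot;\theta'_{n'})$; 2. the family $(W_{i-1}-W_i)_{i=2}^n$ is linearly independent in $\mathbb R^d$, and so is $(W'_{i-1}-W'_i)_{i=2}^{n'}$. Then $n=n'$, and there exist $c_W\in\mathbb R^d$, $c_b\in\mathbb R$ and a permutation $\tau$ of $\{1,\dots,n\}$ such that for all $i=1,\dots,n$, $$W_i'=W_{\tau(i)}+c_W,\qquad b_i'=b_{\tau(i)}+c_b,$$ and $\mathcal E(x;\theta_i')=\mathcal E(x;\theta_{\tau(i)})$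 for all $x\in\Omega(\{W_i,b_i\}_{i=1}^n)$ such that $\tau(i)\in\mathrm{Top}\text{-}k\big((W_jx+b_j)_{j=1}^n\big)$. -/

import Mathlib

noncomputable section

namespace SMoE

/-- Parameters of a feedforward network with input dimension `m`, hidden widths `hidden`
(in order from input to output) and output dimension `p`: a weight matrix and a bias vector
for each of the `hidden.length + 1` affine layers. -/
def NetParam : ℕ → List ℕ → ℕ → Type
  | m, [], p => Matrix (Fin m) (Fin p) ℝ × (Fin p → ℝ)
  | m, h :: t, p => (Matrix (Fin m) (Fin h) ℝ × (Fin h → ℝ)) × NetParam h t p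

/-- The componentwise rectifier. -/
def relu {m : ℕ} (v : Fin m → ℝ) : Fin m → ℝ := fun i => max 0 (v i)

/-- The affine layer `x ↦ x A + b` (row-vector convention). -/
def affineLayer {m p : ℕ} (A : Matrix (Fin m) (Fin p) ℝ × (Fin p → ℝ)) (x : Fin m → ℝ) :
    Fin p → ℝ :=
  Matrix.vecMul x A.1 + A.2

/-- The ReLU network `f_L ∘ relu ∘ f_{L-1} ∘ ⋯ ∘ relu ∘ f_1`. -/
def net : (m : ℕ) → (hidden : List ℕ) → (p : ℕ) →
    NetParam m hidden p → (Fin m → ℝ) → (Fin p → ℝ)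
  | _, [], _, θ, x => affineLayer θ x
  | _, h :: t, p, θ, x => net h t p θ.2 (relu (affineLayer θ.1 x))

/-- The weight space of experts `ℝ^d → ℝ^d` with the architecture given by `hidden`. -/
abbrev ExpertParam (d : ℕ) (hidden : List ℕ) : Type := NetParam d hidden d

/-- The expert function `x ↦ 𝓔(x; θ)`. -/
def expert {d : ℕ} {hidden : List ℕ} (θ : ExpertParam d hidden) (x : Fin d → ℝ) :
    Fin d → ℝ :=
  net d hidden d θ x

/-- The weight space `Φ(n)` of mixtures of `n` experts. -/
structure Param (d : ℕ) (hidden : List ℕ) (n : ℕ) where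
  /-- gating weights -/
  W : Fin n → Fin d → ℝ
  /-- gating biases -/
  b : Fin n → ℝ
  /-- expert parameters -/
  θ : Fin n → ExpertParam d hidden

/-- The gating scores `(W_i x + b_i)_i`. -/
def score {d n : ℕ} (W : Fin n → Fin d → ℝ) (b : Fin n → ℝ) (x : Fin d → ℝ) : Fin n → ℝ :=
  fun i => W i ⬝ᵥ x + b i

/-- The set of indices of the `k` largest components of `z`, smaller indices being selected
first in the event of ties: `i` is selected iff fewer than `k` indices precede it in the order
"larger component first, then smaller index first". -/
def topK {n : ℕ} (k : ℕ) (z : Fin n → ℝ) : Finset (Fin n) :=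
  Finset.univ.filter fun i =>
    (Finset.univ.filter fun j => z i < z j ∨ (z j = z i ∧ j < i)).card < k

/-- The `i`-th component of the softmax of the subfamily `(z_j)_{j ∈ T}`. -/
def softmax {n : ℕ} (T : Finset (Fin n)) (z : Fin n → ℝ) (i : Fin n) : ℝ :=
  Real.exp (z i) / ∑ j ∈ T, Real.exp (z j)

/-- The mixture of experts with Top-`k` sparse gating. -/
def smoe {d n : ℕ} {hidden : List ℕ} (k : ℕ) (φ : Param d hidden n) (x : Fin d → ℝ) :
    Fin d → ℝ :=
  ∑ i ∈ topK k (score φ.W φ.b x),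
    softmax (topK k (score φ.W φ.b x)) (score φ.W φ.b x) i • expert (φ.θ i) x

/-- The set of inputs at which the gating scores are pairwise distinct. -/
def tieFree {d n : ℕ} (W : Fin n → Fin d → ℝ) (b : Fin n → ℝ) : Set (Fin d → ℝ) :=
  {x | Function.Injective (score W b x)}

/-- Two functions are strongly distinct if they differ on a dense set. -/
def StronglyDistinct {X Y : Type*} [TopologicalSpace X] (f g : X → Y) : Prop :=
  Dense {x | f x ≠ g x}

/-- The `n - 1` consecutive differences of a family of `n` vectors. -/
def consecutiveDiff {d n : ℕ} (W : Fin n → Fin d → ℝ) (i : Fin (n - 1)) : Fin d → ℝ :=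
  W ⟨i.1, by omega⟩ - W ⟨i.1 + 1, by omega⟩

end SMoE

end

/-! Call an input regular if it is tie-free for both mixtures and all experts are affine near it;
such inputs form a dense open set. Near one, both active sets are constant. Clearing the softmax
denominators turns equality of the mixtures into `∑ exp(s_i + s'_j) • (A_i - B_j) = 0`, summed over
active pairs `(i, j)`, with `A_i`, `B_j` the affine germs of the experts. Exponentials of distinct
linear forms are independent over affine functions, so the sum vanishes separately over each class
of pairs with the same `W_i + W'_j`. A class with a single pair forces `A_i = B_j`. Strong
distinctness makes germs of different experts distinct, so these equalities form a partial matching;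
affine independence of the `W_i` exposes each of them as a vertex and makes the matching a
translation (`exists_equiv_translate`). Classes with two pairs then align the biases
(`exists_equiv_of_sum_exp_eq_zero`).

It remains to see that the local shift `(c, γ)` is the same everywhere. Every `k`-subset is active
somewhere, so active sets can be joined by exchanging one index at a time. Two active sets sharing
two indices give the same shift, but for `k = 2` an exchange keeps only one. Then `exists_crossing`
compares the two sides of the hyperplane where the exchange occurs: score comparisons of the second
mixture that flip there have normals that are nonnegative multiples of `W_j - W_l`, and
`translation_eq_of_adjacent` deduces that the shifts agree. Finally, every expert is active at some
regular input, and density with continuity extends the expert identity to all tie-free inputs of the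
first mixture. -/

namespace SMoE

open Filter Topology

/-! ### Linear independence of exponentials with affine coefficients -/

/-- Real-affine continuous maps between normed spaces. -/
def IsAffineFun {E F : Type*} [NormedAddCommGroup E] [NormedSpace ℝ E] [NormedAddCommGroup F]
    [NormedSpace ℝ F] (f : E → F) : Prop :=
  ∃ (L : E →L[ℝ] F) (c : F), ∀ y, f y = L y + c

namespace IsAffineFun

variable {E F : Type*} [NormedAddCommGroup E] [NormedSpace ℝ E] [NormedAddCommGroup F]
  [NormedSpace ℝ F] {f g : E → F}

theorem sub (hf : IsAffineFun f) (hg : IsAffineFun g) : IsAffineFun fun y => f y - g y := by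
  obtain ⟨L, c, h⟩ := hf
  obtain ⟨M, e, h'⟩ := hg
  refine ⟨L - M, c - e, fun y => ?_⟩
  simp only [h, h', sub_apply]
  abel

theorem const_smul (r : ℝ) (hf : IsAffineFun f) : IsAffineFun fun y => r • f y := by
  obtain ⟨L, c, h⟩ := hf
  exact ⟨r • L, r • c, fun y => by simp [h]⟩

theorem sum {ι : Type*} (s : Finset ι) {f : ι → E → F} (hf : ∀ i, IsAffineFun (f i)) :
    IsAffineFun fun y => ∑ i ∈ s, f i y := by
  choose L c h using hf
  refine ⟨∑ i ∈ s, L i, ∑ i ∈ s, c i, fun y => ?_⟩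
  simp [h, Finset.sum_add_distrib]

theorem analyticAt (hf : IsAffineFun f) (x : E) : AnalyticAt ℝ f x := by
  obtain ⟨L, c, h⟩ := hf
  rw [show f = fun y => L y + c from funext h]
  exact (L.analyticAt x).add analyticAt_const

theorem second_difference (hf : IsAffineFun f) (y v : E) :
    f (y + v + v) - (2 : ℝ) • f (y + v) + f y = 0 := by
  obtain ⟨L, c, h⟩ := hf
  simp only [h, map_add, two_smul]
  abel

end IsAffineFun

theorem continuous_dotProduct_const {d : ℕ} (w : Fin d → ℝ) :
    Continuous fun y : Fin d → ℝ => w ⬝ᵥ y := by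
  unfold dotProduct
  fun_prop

theorem analyticAt_dotProduct {d : ℕ} (w x : Fin d → ℝ) :
    AnalyticAt ℝ (fun y : Fin d → ℝ => w ⬝ᵥ y) x := by
  have h : (fun y : Fin d → ℝ => w ⬝ᵥ y) = fun y => ∑ i, w i * ContinuousLinearMap.proj (R := ℝ)
      (φ := fun _ : Fin d => ℝ) i y := by
    ext y
    simp [dotProduct]
  rw [h]
  exact Finset.analyticAt_fun_sum _ fun i _ =>
    analyticAt_const.mul (ContinuousLinearMap.analyticAt (𝕜 := ℝ) (E := Fin d → ℝ) (F := ℝ)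
      (ContinuousLinearMap.proj (R := ℝ) (φ := fun _ : Fin d => ℝ) i) x)

/-- A vector whose dot products with the elements of a finite set are pairwise distinct. -/
theorem exists_injOn_dotProduct {d : ℕ} (s : Finset (Fin d → ℝ)) :
    ∃ v : Fin d → ℝ, Set.InjOn (fun u => u ⬝ᵥ v) (s : Set (Fin d → ℝ)) := by
  let D := {p : s × s // p.1 ≠ p.2}
  obtain ⟨v, hv⟩ := Module.Dual.exists_forall_ne_zero_of_forall_exists (K := ℝ)
    (M := Fin d → ℝ) (ι := D)
    (fun p => dotProductBilin ℝ ℝ ((p.1.1 : Fin d → ℝ) - (p.1.2 : Fin d → ℝ))) (by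
      rintro ⟨p, hp⟩
      refine ⟨(p.1 : Fin d → ℝ) - (p.2 : Fin d → ℝ), fun h => hp ?_⟩
      have h0 : ((p.1 : Fin d → ℝ) - (p.2 : Fin d → ℝ)) ⬝ᵥ
        ((p.1 : Fin d → ℝ) - (p.2 : Fin d → ℝ)) = 0 := h
      exact Subtype.ext (sub_eq_zero.mp (dotProduct_self_eq_zero.mp h0)))
  refine ⟨v, fun a ha b hb hab => ?_⟩
  by_contra hne
  refine hv ⟨(⟨a, ha⟩, ⟨b, hb⟩), fun h => hne (congrArg Subtype.val h)⟩ ?_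
  change (a - b) ⬝ᵥ v = 0
  rw [sub_dotProduct]
  exact sub_eq_zero.mpr hab

/-- Translation of functions by a vector. -/
def translation {E F : Type*} [AddCommGroup E] [AddCommGroup F] [Module ℝ F] (v : E) :
    Module.End ℝ (E → F) where
  toFun f y := f (y + v)
  map_add' _ _ := rfl
  map_smul' _ _ := rfl

/-- Applying translation minus `exp(u ⬝ᵥ v)` twice leaves, up to an exponential factor, the second
difference of `g` along `v`, which vanishes for affine `g`. -/
theorem mem_genEigenspace_translation {d : ℕ} {F : Type*} [NormedAddCommGroup F] [NormedSpace ℝ F]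
    {g : (Fin d → ℝ) → F} (hg : IsAffineFun g) (u v : Fin d → ℝ) :
    (fun y => Real.exp (u ⬝ᵥ y) • g y) ∈
      (translation (F := F) v).genEigenspace (Real.exp (u ⬝ᵥ v)) 2 := by
  have : (2 : ℕ∞) = ((2 : ℕ) : ℕ∞) := rfl
  rw [this, Module.End.mem_genEigenspace_nat, LinearMap.mem_ker]
  ext1 y
  have h := hg.second_difference y v
  have h1 : g (y + v + v) = (2 : ℝ) • g (y + v) - g y := by
    rw [← sub_eq_zero, ← h]
    abel
  simp only [pow_two, Module.End.mul_apply, LinearMap.sub_apply, translation, LinearMap.coe_mk,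
    AddHom.coe_mk, LinearMap.smul_apply, Module.End.one_apply, Pi.sub_apply, Pi.smul_apply,
    dotProduct_add, Real.exp_add, h1, Pi.zero_apply]
  module

/-- Exponentials of distinct linear forms are linearly independent over the affine functions. -/
theorem sum_fiber_eq_zero_of_sum_exp_smul {d : ℕ} {ι F : Type*} [NormedAddCommGroup F]
    [NormedSpace ℝ F] [Fintype ι] [DecidableEq (Fin d → ℝ)]
    (w : ι → Fin d → ℝ) (g : ι → (Fin d → ℝ) → F)
    (hg : ∀ i, IsAffineFun (g i)) (x : Fin d → ℝ)
    (h : ∀ᶠ y in 𝓝 x, ∑ i, Real.exp (w i ⬝ᵥ y) • g i y = 0) (u y : Fin d → ℝ) :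
    ∑ i with w i = u, g i y = 0 := by
  -- The relation is only local, whereas translation operators act on global functions; analyticity
  -- bridges the gap.
  have hglob : ∀ y, ∑ i, Real.exp (w i ⬝ᵥ y) • g i y = 0 := by
    have han : AnalyticOnNhd ℝ (fun y => ∑ i, Real.exp (w i ⬝ᵥ y) • g i y) Set.univ :=
      fun z _ => Finset.analyticAt_fun_sum _ fun i _ =>
        (analyticAt_dotProduct (w i) z).rexp'.smul ((hg i).analyticAt z)
    intro y
    exact han.eqOn_zero_of_preconnected_of_eventuallyEq_zero isPreconnected_univ
      (Set.mem_univ x) h (Set.mem_univ y)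
  obtain ⟨v, hv⟩ := exists_injOn_dotProduct (Finset.univ.image w)
  by_cases hu : u ∈ Finset.univ.image w
  swap
  · refine Finset.sum_eq_zero fun i hi => (hu ?_).elim
    exact Finset.mem_image.mpr ⟨i, Finset.mem_univ _, (Finset.mem_filter.mp hi).2⟩
  -- Since `v` separates the exponents, the classes lie in generalized eigenspaces for distinct
  -- eigenvalues, which are independent.
  have hind := ((translation (F := F) v).independent_genEigenspace 2).comp
    (f := fun p : (Finset.univ.image w : Finset _) => Real.exp ((p : Fin d → ℝ) ⬝ᵥ v))
    (fun p q hpq => Subtype.ext (hv p.2 q.2 (Real.exp_injective hpq)))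
  rw [iSupIndep_iff_finsetSum_eq_zero_imp_eq_zero] at hind
  have key := hind Finset.univ
    (fun p (y : Fin d → ℝ) => Real.exp ((p : Fin d → ℝ) ⬝ᵥ y) • ∑ i with w i = p, g i y)
    (fun p _ => mem_genEigenspace_translation (IsAffineFun.sum _ hg) p v) (by
      ext1 y
      rw [Finset.sum_apply, Pi.zero_apply, ← hglob y,
        ← Finset.sum_fiberwise_of_maps_to (s := Finset.univ) (t := Finset.univ.image w) (g := w)
          (fun i _ => Finset.mem_image_of_mem _ (Finset.mem_univ i)),
        ← Finset.sum_coe_sort (Finset.univ.image w)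
          (fun u => ∑ i with w i = u, Real.exp (w i ⬝ᵥ y) • g i y)]
      refine Finset.sum_congr rfl fun p _ => ?_
      rw [Finset.smul_sum]
      refine Finset.sum_congr rfl fun i hi => ?_
      rw [(Finset.mem_filter.mp hi).2])
    ⟨u, hu⟩ (Finset.mem_univ _)
  have := congrFun key y
  exact (smul_eq_zero.mp this).resolve_left (Real.exp_pos _).ne'

/-! ### Families with freely prescribable differences -/

/-- The dual form of affine independence: all families of reals are realized, up to a common
constant, as dot products with a single vector. -/
def RealizesDifferences {ι : Type*} {d : ℕ} (a : ι → Fin d → ℝ) : Prop :=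
  ∀ y : ι → ℝ, ∃ (h : Fin d → ℝ) (c : ℝ), ∀ i, a i ⬝ᵥ h = y i + c

namespace RealizesDifferences

variable {ι κ : Type*} {d : ℕ} {a : ι → Fin d → ℝ}

theorem injective (ha : RealizesDifferences a) : Function.Injective a := by
  classical
  intro i j hij
  by_contra hne
  obtain ⟨h, c, hc⟩ := ha (Pi.single i 1)
  have h1 := hc i
  have h2 := hc j
  rw [hij] at h1
  simp [Ne.symm hne] at h1 h2
  linarith

theorem comp (ha : RealizesDifferences a) {f : κ → ι} (hf : Function.Injective f) :
    RealizesDifferences (a ∘ f) := by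
  intro y
  obtain ⟨h, c, hc⟩ := ha (Function.extend f y 0)
  exact ⟨h, c, fun i => by simp [hc, hf.extend_apply]⟩

theorem eq_of_sub_eq_sub (ha : RealizesDifferences a) {i j p q : ι} (hij : i ≠ j)
    (h : a i - a j = a p - a q) : i = p ∧ j = q := by
  classical
  constructor
  · obtain ⟨v, c, hc⟩ := ha (Pi.single i 1)
    have := congrArg (· ⬝ᵥ v) h
    simp only [sub_dotProduct, hc, Pi.single_apply] at this
    grind
  · obtain ⟨v, c, hc⟩ := ha (Pi.single j 1)
    have := congrArg (· ⬝ᵥ v) h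
    simp only [sub_dotProduct, hc, Pi.single_apply] at this
    grind

/-- If a partial matching contains all pairs `(i, j)` whose sum `a i + b j` has a unique
representation, then it is a bijection under which the two families are translates. -/
theorem exists_equiv_translate [Fintype ι] [Fintype κ] [Nonempty ι]
    (hcard : Fintype.card ι = Fintype.card κ) {b : κ → Fin d → ℝ}
    (ha : RealizesDifferences a) (hb : Function.Injective b) (R : ι → κ → Prop)
    (hleft : ∀ i i' j, R i j → R i' j → i = i') (hright : ∀ i j j', R i j → R i j' → j = j')
    (hR : ∀ i j, (∀ p q, a i + b j = a p + b q → p = i ∧ q = j) → R i j) :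
    ∃ (f : ι ≃ κ) (c : Fin d → ℝ), (∀ i, b (f i) = a i + c) ∧ ∀ i, R i (f i) := by
  classical
  have : Nonempty κ := by
    rw [← Fintype.card_pos_iff, ← hcard]
    exact Fintype.card_pos
  -- In a direction where `a i` is the strict maximum and `b j` a maximum, `a i + b j` has no other
  -- representation.
  have hmax : ∀ i j v, (∀ p, p ≠ i → a p ⬝ᵥ v < a i ⬝ᵥ v) → (∀ q, b q ⬝ᵥ v ≤ b j ⬝ᵥ v) →
      R i j := by
    intro i j v hi hj
    refine hR i j fun p q hpq => ?_
    have h := congrArg (· ⬝ᵥ v) hpq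
    simp only [add_dotProduct] at h
    have hp : p = i := by
      by_contra hp
      linarith [hi p hp, hj q]
    subst hp
    exact ⟨rfl, hb (add_left_cancel hpq).symm⟩
  have hstrict : ∀ i, ∃ v, ∀ p, p ≠ i → a p ⬝ᵥ v < a i ⬝ᵥ v := by
    intro i
    obtain ⟨v, c, hc⟩ := ha (Pi.single i 1)
    refine ⟨v, fun p hp => ?_⟩
    simp [hc, hp]
  obtain ⟨l⟩ := ‹Nonempty ι›
  obtain ⟨v₀, hv₀⟩ := hstrict l
  obtain ⟨m, hm⟩ := Finite.exists_max fun q => b q ⬝ᵥ v₀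
  have hlm : R l m := hmax l m v₀ hv₀ hm
  -- As `R` pairs `l` with at most one index, `b m` is maximal in every direction exposing `a l`.
  have hmv : ∀ v, (∀ p, p ≠ l → a p ⬝ᵥ v < a l ⬝ᵥ v) → ∀ q, b q ⬝ᵥ v ≤ b m ⬝ᵥ v := by
    intro v hv q
    obtain ⟨j, hj⟩ := Finite.exists_max fun q => b q ⬝ᵥ v
    rw [hright l m j hlm (hmax l j v hv hj)]
    exact hj q
  have key : ∀ i, ∃ j, b j = a i + (b m - a l) := by
    intro i
    by_cases hil : i = l
    · exact ⟨m, by rw [hil]; abel⟩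
    have hnot : ¬ R i m := fun h => hil (hleft i l m h hlm)
    have h := mt (hR i m) hnot
    push Not at h
    obtain ⟨p, q, hpq, hne⟩ := h
    have hpi : p ≠ i := by
      rintro rfl
      exact hne rfl (hb (add_left_cancel hpq).symm)
    have hpl : p = l := by
      by_contra hpl
      -- This direction exposes `a l`, so `b q` does not exceed `b m`, while `a p` is strictly below
      -- `a i`; this contradicts `hpq`.
      obtain ⟨v, c, hc⟩ := ha fun r => if r = l then 2 else if r = p then 0 else 1
      have h1 := hmv v (fun r hr => by rw [hc, hc]; simp [hr]; split_ifs <;> norm_num) q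
      have h2 := congrArg (· ⬝ᵥ v) hpq
      simp only [add_dotProduct, hc, if_neg hil, if_neg hpl, if_neg hpi.symm, if_true] at h2
      linarith
    refine ⟨q, ?_⟩
    rw [← hpl, ← add_sub_assoc, hpq]
    abel
  choose f hf using key
  have hinj : Function.Injective f := by
    intro i j hij
    have := hf i
    rw [hij, hf j] at this
    exact ha.injective (add_right_cancel this).symm
  have hbij : Function.Bijective f := (Fintype.bijective_iff_injective_and_card f).mpr ⟨hinj, hcard⟩
  refine ⟨Equiv.ofBijective f hbij, b m - a l, hf, fun i => ?_⟩
  obtain ⟨v, hv⟩ := hstrict i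
  refine hmax i _ v hv fun q => ?_
  obtain ⟨p, rfl⟩ := hbij.2 q
  simp only [Equiv.ofBijective_apply, hf, add_dotProduct]
  by_cases hp : p = i
  · rw [hp]
  · linarith [hv p hp]

end RealizesDifferences

/-- Local identification of the active gating parameters and experts of two mixtures whose active
experts are affine. -/
theorem exists_equiv_of_sum_exp_eq_zero {ι κ F : Type*} [Fintype ι] [Fintype κ] [Nonempty ι]
    [NormedAddCommGroup F] [NormedSpace ℝ F] {d : ℕ}
    (hcard : Fintype.card ι = Fintype.card κ)
    {a : ι → Fin d → ℝ} {b : κ → Fin d → ℝ} (ha : RealizesDifferences a)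
    (hb : Function.Injective b) (α : ι → ℝ) (β : κ → ℝ)
    {A : ι → (Fin d → ℝ) → F} {B : κ → (Fin d → ℝ) → F} (hA : ∀ i, IsAffineFun (A i))
    (hB : ∀ j, IsAffineFun (B j)) (hAinj : Function.Injective A) (hBinj : Function.Injective B)
    {x : Fin d → ℝ}
    (hsum : ∀ᶠ y in 𝓝 x, ∑ i, ∑ j,
      (Real.exp (a i ⬝ᵥ y + α i) * Real.exp (b j ⬝ᵥ y + β j)) • (A i y - B j y) = 0) :
    ∃ (f : ι ≃ κ) (c : Fin d → ℝ) (γ : ℝ),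
      ∀ i, b (f i) = a i + c ∧ β (f i) = α i + γ ∧ A i = B (f i) := by
  classical
  have hfib := sum_fiber_eq_zero_of_sum_exp_smul (fun p : ι × κ => a p.1 + b p.2)
    (fun p y => Real.exp (α p.1 + β p.2) • (A p.1 y - B p.2 y))
    (fun p => ((hA p.1).sub (hB p.2)).const_smul _) x (by
      filter_upwards [hsum] with y hy
      rw [← hy, Fintype.sum_prod_type]
      refine Finset.sum_congr rfl fun i _ => Finset.sum_congr rfl fun j _ => ?_
      rw [smul_smul, ← Real.exp_add, ← Real.exp_add, add_dotProduct]
      congr 2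
      ring)
  obtain ⟨f, c, hc, hR⟩ := ha.exists_equiv_translate hcard hb (fun i j => A i = B j)
    (fun i i' j h h' => hAinj (h.trans h'.symm)) (fun i j j' h h' => hBinj (h.symm.trans h'))
    (fun i j huniq => by
      ext1 y
      have h := hfib (a i + b j) y
      rw [Finset.sum_eq_single_of_mem (i, j) (by simp)] at h
      · exact sub_eq_zero.mp ((smul_eq_zero.mp h).resolve_left (Real.exp_pos _).ne')
      · rintro ⟨p, q⟩ hpq hne
        have := huniq p q (Finset.mem_filter.mp hpq).2.symm
        exact (hne (by rw [this.1, this.2])).elim)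
  obtain ⟨l⟩ := ‹Nonempty ι›
  refine ⟨f, c, β (f l) - α l, fun i => ⟨hc i, ?_, hR i⟩⟩
  by_cases hil : i = l
  · rw [hil]; ring
  obtain ⟨y, hy⟩ : ∃ y, A i y ≠ A l y := by
    by_contra! h
    exact hil (hAinj (funext h))
  have h := hfib (a i + b (f l)) y
  -- With `b ∘ f = a + c`, the class collects the ways to write `a i + a l` as `a p + a q`; affine
  -- independence leaves only the two orderings.
  have hset : (Finset.univ.filter fun p : ι × κ => a p.1 + b p.2 = a i + b (f l)) =
      {(i, f l), (l, f i)} := by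
    ext ⟨p, q⟩
    obtain ⟨q, rfl⟩ := f.surjective q
    simp only [Finset.mem_filter, Finset.mem_univ, true_and, Finset.mem_insert,
      Finset.mem_singleton, Prod.mk.injEq, EmbeddingLike.apply_eq_iff_eq, hc]
    constructor
    · intro h
      by_cases hp : p = i
      · refine Or.inl ⟨hp, ha.injective ?_⟩
        rw [hp] at h
        exact add_right_cancel (add_left_cancel h)
      · refine Or.inr ?_
        refine (ha.eq_of_sub_eq_sub hp (p := l) (q := q) ?_).imp_right Eq.symm
        have h' : a p + a q + c = a i + a l + c := by simpa [add_assoc] using h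
        rw [sub_eq_sub_iff_add_eq_add, add_right_cancel h', add_comm]
    · rintro (⟨rfl, rfl⟩ | ⟨rfl, rfl⟩)
      · rfl
      · abel
  rw [hset, Finset.sum_pair (by simp [hil])] at h
  simp only [← hR] at h
  have h2 : (Real.exp (α i + β (f l)) - Real.exp (α l + β (f i))) • (A i y - A l y) = 0 := by
    rw [← h]
    module
  have h3 := (smul_eq_zero.mp h2).resolve_right (sub_ne_zero.mpr hy)
  have h4 := Real.exp_injective (sub_eq_zero.mp h3)
  linarith

/-- Linear independence of the consecutive differences lets all score differences be prescribed. -/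
theorem realizesDifferences_of_linearIndependent {d n : ℕ} {W : Fin n → Fin d → ℝ}
    (hW : LinearIndependent ℝ (consecutiveDiff W)) : RealizesDifferences W := by
  intro y
  obtain ⟨f, hf⟩ : ∃ f : (Fin d → ℝ) →ₗ[ℝ] ℝ, ∀ i : Fin (n - 1),
      f (consecutiveDiff W i) = y ⟨i.1, by omega⟩ - y ⟨i.1 + 1, by omega⟩ := by
    -- Values may be prescribed on the independent differences; the functional is extended to the
    -- whole space and then represented by a dot product.
    obtain ⟨f, hf⟩ := LinearMap.exists_extend
      ((Finsupp.linearCombination ℝ fun i : Fin (n - 1) =>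
        y ⟨i.1, by omega⟩ - y ⟨i.1 + 1, by omega⟩).comp hW.repr)
    refine ⟨f, fun i => ?_⟩
    have := LinearMap.congr_fun hf ⟨consecutiveDiff W i, Submodule.subset_span ⟨i, rfl⟩⟩
    simp only [LinearMap.comp_apply, Submodule.subtype_apply] at this
    rw [this, hW.repr_eq_single i _ rfl]
    simp
  have hdot : ∀ w : Fin d → ℝ, w ⬝ᵥ (fun i => f (Pi.single i 1)) = f w := by
    intro w
    rw [LinearMap.pi_apply_eq_sum_univ f w]
    simp only [dotProduct, smul_eq_mul]
    refine Finset.sum_congr rfl fun i _ => ?_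
    congr 2
    ext j
    simp [Pi.single_apply, eq_comm]
  rcases Nat.eq_zero_or_pos n with rfl | hn
  · exact ⟨0, 0, fun i => i.elim0⟩
  refine ⟨fun i => f (Pi.single i 1), f (W ⟨0, hn⟩) - y ⟨0, hn⟩, ?_⟩
  rintro ⟨i, hi⟩
  rw [hdot]
  induction i with
  | zero => ring
  | succ i ih =>
    have h1 := ih (by omega)
    have h2 := hf ⟨i, by omega⟩
    simp only [consecutiveDiff, map_sub] at h2
    linarith

/-! ### ReLU networks are locally affine on a dense open set -/

/-- `f` agrees with an affine map near `x`. -/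
def LocallyAffineAt {E F : Type*} [NormedAddCommGroup E] [NormedSpace ℝ E]
    [NormedAddCommGroup F] [NormedSpace ℝ F] (f : E → F) (x : E) : Prop :=
  ∃ A : E → F, IsAffineFun A ∧ ∀ᶠ y in 𝓝 x, f y = A y

theorem isOpen_setOf_locallyAffineAt {E F : Type*} [NormedAddCommGroup E] [NormedSpace ℝ E]
    [NormedAddCommGroup F] [NormedSpace ℝ F] (f : E → F) : IsOpen {x | LocallyAffineAt f x} := by
  rw [isOpen_iff_mem_nhds]
  rintro x ⟨A, hA, h⟩
  filter_upwards [h.eventually_nhds] with y hy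
  exact ⟨A, hA, hy⟩

theorem continuous_relu {m : ℕ} : Continuous (relu (m := m)) := by
  unfold relu
  fun_prop

theorem IsAffineFun.affineLayer_comp {E : Type*} [NormedAddCommGroup E] [NormedSpace ℝ E] {m p : ℕ}
    (A : Matrix (Fin m) (Fin p) ℝ × (Fin p → ℝ)) {g : E → Fin m → ℝ} (hg : IsAffineFun g) :
    IsAffineFun fun y => affineLayer A (g y) := by
  obtain ⟨L, c, h⟩ := hg
  refine ⟨(LinearMap.toContinuousLinearMap (Matrix.vecMulLinear A.1)).comp L,
    affineLayer A c, fun y => ?_⟩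
  simp [affineLayer, h, Matrix.add_vecMul, add_assoc]

theorem continuous_affineLayer {m p : ℕ} (A : Matrix (Fin m) (Fin p) ℝ × (Fin p → ℝ)) :
    Continuous (affineLayer A) := by
  obtain ⟨L, c, h⟩ := IsAffineFun.affineLayer_comp A
    (⟨ContinuousLinearMap.id ℝ _, 0, fun y => by simp⟩ : IsAffineFun fun y : Fin m → ℝ => y)
  rw [show affineLayer A = fun y => L y + c from funext h]
  fun_prop

theorem continuous_net : ∀ (m : ℕ) (hidden : List ℕ) (p : ℕ) (θ : NetParam m hidden p),
    Continuous (net m hidden p θ)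
  | _, [], _, θ => continuous_affineLayer θ
  | _, h :: t, p, θ =>
    (continuous_net h t p θ.2).comp (continuous_relu.comp (continuous_affineLayer θ.1))

theorem continuous_expert {d : ℕ} {hidden : List ℕ} (θ : ExpertParam d hidden) :
    Continuous (expert θ) :=
  continuous_net d hidden d θ

/-- One coordinate at a time: either it is positive somewhere, and the open set shrinks to where it
is, or it is nonpositive throughout. -/
theorem exists_open_signs_const {E : Type*} [TopologicalSpace E] {m : ℕ} {g : E → Fin m → ℝ}
    (hg : Continuous g) {U : Set E} (hU : IsOpen U) (hne : U.Nonempty) (s : Finset (Fin m)) :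
    ∃ V ⊆ U, IsOpen V ∧ V.Nonempty ∧
      ∀ i ∈ s, (∀ y ∈ V, 0 ≤ g y i) ∨ ∀ y ∈ V, g y i ≤ 0 := by
  induction s using Finset.induction_on with
  | empty => exact ⟨U, subset_rfl, hU, hne, by simp⟩
  | insert i s _ ih =>
    obtain ⟨V, hVU, hV, hVne, hs⟩ := ih
    by_cases h : ∃ y ∈ V, 0 < g y i
    · obtain ⟨y, hyV, hy⟩ := h
      refine ⟨V ∩ {y | 0 < g y i}, Set.inter_subset_left.trans hVU,
        hV.inter (isOpen_lt continuous_const ((continuous_apply i).comp hg)), ⟨y, hyV, hy⟩, ?_⟩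
      intro j hj
      rcases Finset.mem_insert.mp hj with rfl | hj
      · exact Or.inl fun y hy => le_of_lt hy.2
      · exact (hs j hj).imp (fun h y hy => h y hy.1) (fun h y hy => h y hy.1)
    · push Not at h
      refine ⟨V, hVU, hV, hVne, fun j hj => ?_⟩
      rcases Finset.mem_insert.mp hj with rfl | hj
      · exact Or.inr h
      · exact hs j hj

theorem IsAffineFun.continuous {E F : Type*} [NormedAddCommGroup E] [NormedSpace ℝ E]
    [NormedAddCommGroup F] [NormedSpace ℝ F] {f : E → F} (hf : IsAffineFun f) : Continuous f := by
  obtain ⟨L, c, h⟩ := hf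
  rw [show f = fun y => L y + c from funext h]
  fun_prop

theorem exists_open_relu_eq_affine {E : Type*} [NormedAddCommGroup E] [NormedSpace ℝ E] {m : ℕ}
    {g : E → Fin m → ℝ} (hg : IsAffineFun g) {U : Set E} (hU : IsOpen U) (hne : U.Nonempty) :
    ∃ V ⊆ U, IsOpen V ∧ V.Nonempty ∧
      ∃ A : E → Fin m → ℝ, IsAffineFun A ∧ ∀ y ∈ V, relu (g y) = A y := by
  classical
  obtain ⟨V, hVU, hV, hVne, hs⟩ := exists_open_signs_const hg.continuous hU hne Finset.univ
  obtain ⟨L, c, h⟩ := hg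
  refine ⟨V, hVU, hV, hVne, fun y i => if ∀ y ∈ V, 0 ≤ g y i then g y i else 0, ?_, ?_⟩
  · refine ⟨ContinuousLinearMap.pi fun i =>
      if ∀ y ∈ V, 0 ≤ g y i then (ContinuousLinearMap.proj i).comp L else 0,
      fun i => if ∀ y ∈ V, 0 ≤ g y i then c i else 0, fun y => ?_⟩
    ext i
    simp only [Pi.add_apply, ContinuousLinearMap.pi_apply]
    split_ifs with hi
    · simp [h]
    · simp
  · intro y hy
    ext i
    simp only [relu]
    split_ifs with hi
    · exact max_eq_right (hi y hy)
    · exact max_eq_left (((hs i (Finset.mem_univ i)).resolve_left hi) y hy)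

theorem exists_open_net_eq_affine {E : Type*} [NormedAddCommGroup E] [NormedSpace ℝ E] :
    ∀ (m : ℕ) (hidden : List ℕ) (p : ℕ) (θ : NetParam m hidden p) {g : E → Fin m → ℝ},
      IsAffineFun g → ∀ {U : Set E}, IsOpen U → U.Nonempty →
      ∃ V ⊆ U, IsOpen V ∧ V.Nonempty ∧
        ∃ A : E → Fin p → ℝ, IsAffineFun A ∧ ∀ y ∈ V, net m hidden p θ (g y) = A y
  | _, [], _, θ, _, hg, U, hU, hne =>
    ⟨U, subset_rfl, hU, hne, _, hg.affineLayer_comp θ, fun _ _ => rfl⟩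
  | _, h :: t, p, θ, _, hg, _, hU, hne => by
    obtain ⟨V, hVU, hV, hVne, A, hA, hAV⟩ :=
      exists_open_relu_eq_affine (hg.affineLayer_comp θ.1) hU hne
    obtain ⟨V', hVV', hV', hVne', B, hB, hBV⟩ := exists_open_net_eq_affine h t p θ.2 hA hV hVne
    refine ⟨V', hVV'.trans hVU, hV', hVne', B, hB, fun y hy => ?_⟩
    rw [← hBV y hy, ← hAV y (hVV' hy)]
    rfl

theorem dense_setOf_locallyAffineAt_expert {d : ℕ} {hidden : List ℕ} (θ : ExpertParam d hidden) :
    Dense {x | LocallyAffineAt (expert θ) x} := by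
  rw [dense_iff_inter_open]
  intro U hU hne
  obtain ⟨V, hVU, hV, ⟨x, hx⟩, A, hA, hAV⟩ := exists_open_net_eq_affine d hidden d θ
    (⟨ContinuousLinearMap.id ℝ _, 0, fun y => by simp⟩ : IsAffineFun fun y : Fin d → ℝ => y) hU hne
  exact ⟨x, hVU hx, A, hA, Filter.mem_of_superset (hV.mem_nhds hx) hAV⟩

/-! ### Scores and Top-`k` selection -/

theorem continuous_score {d n : ℕ} (W : Fin n → Fin d → ℝ) (b : Fin n → ℝ) :
    Continuous (score W b) :=
  continuous_pi fun i => (continuous_dotProduct_const (W i)).add continuous_const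

theorem score_add_smul {d n : ℕ} (W : Fin n → Fin d → ℝ) (b : Fin n → ℝ) (x h : Fin d → ℝ) (t : ℝ)
    (i : Fin n) : score W b (x + t • h) i = score W b x i + t * (W i ⬝ᵥ h) := by
  simp only [score, dotProduct_add, dotProduct_smul, smul_eq_mul]
  ring

theorem tieFree_eq_iInter {d n : ℕ} (W : Fin n → Fin d → ℝ) (b : Fin n → ℝ) :
    tieFree W b = ⋂ p : {p : Fin n × Fin n // p.1 ≠ p.2},
      {x | score W b x p.1.1 ≠ score W b x p.1.2} := by
  ext x
  simp only [tieFree, Set.mem_ofPred_eq, Set.mem_iInter, Subtype.forall, Prod.forall]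
  exact ⟨fun h i j hij => h.ne hij, fun h i j hij => by_contra fun hne => h i j hne hij⟩

theorem isOpen_setOf_score_ne {d n : ℕ} (W : Fin n → Fin d → ℝ) (b : Fin n → ℝ) (i j : Fin n) :
    IsOpen {x | score W b x i ≠ score W b x j} :=
  isOpen_ne_fun ((continuous_apply i).comp (continuous_score W b))
    ((continuous_apply j).comp (continuous_score W b))

theorem isOpen_tieFree {d n : ℕ} (W : Fin n → Fin d → ℝ) (b : Fin n → ℝ) :
    IsOpen (tieFree W b) := by
  rw [tieFree_eq_iInter]
  exact isOpen_iInter_of_finite fun p => isOpen_setOf_score_ne W b _ _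

theorem dense_setOf_score_ne {d n : ℕ} {W : Fin n → Fin d → ℝ} (b : Fin n → ℝ) {i j : Fin n}
    (hij : W i ≠ W j) : Dense {x | score W b x i ≠ score W b x j} := by
  intro x
  by_cases hx : score W b x i = score W b x j
  swap
  · exact subset_closure hx
  -- Moving along `W i - W j` changes the score gap at the nonzero rate `|W i - W j|²`, so the tie
  -- breaks at once.
  have hlim : Tendsto (fun t : ℝ => x + t • (W i - W j)) (𝓝[≠] 0) (𝓝 x) := by
    have : Continuous fun t : ℝ => x + t • (W i - W j) := by fun_prop
    simpa using (this.tendsto 0).mono_left nhdsWithin_le_nhds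
  refine mem_closure_of_tendsto hlim ?_
  filter_upwards [self_mem_nhdsWithin] with t ht
  rw [score_add_smul, score_add_smul, hx, Ne, add_right_inj,
    mul_right_inj' ht, ← sub_eq_zero, ← sub_dotProduct]
  exact fun h => hij (sub_eq_zero.mp (dotProduct_self_eq_zero.mp h))

theorem dense_tieFree {d n : ℕ} {W : Fin n → Fin d → ℝ} (hW : Function.Injective W)
    (b : Fin n → ℝ) : Dense (tieFree W b) := by
  rw [tieFree_eq_iInter]
  exact dense_iInter_of_isOpen (fun p => isOpen_setOf_score_ne W b _ _)
    fun p => dense_setOf_score_ne b (hW.ne p.2)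

theorem topK_eq_of_forall_lt {n k : ℕ} {z : Fin n → ℝ} {T : Finset (Fin n)} (hT : T.card = k)
    (h : ∀ i ∈ T, ∀ j ∉ T, z j < z i) : topK k z = T := by
  ext i
  simp only [topK, Finset.mem_filter, Finset.mem_univ, true_and]
  constructor
  · intro hi
    by_contra hiT
    refine hi.not_ge (hT ▸ Finset.card_le_card fun j hj => ?_)
    simp [h j hj i hiT]
  · intro hi
    refine hT ▸ Finset.card_lt_card ⟨fun j hj => ?_, fun hsub => ?_⟩
    · by_contra hjT
      have := h i hi j hjT
      rcases (Finset.mem_filter.mp hj).2 with h' | h'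
      · exact lt_asymm this h'
      · exact this.ne h'.1
    · simpa using hsub hi

theorem mem_topK_iff_of_injective {n k : ℕ} {z : Fin n → ℝ} (hz : Function.Injective z)
    (i : Fin n) : i ∈ topK k z ↔ (Finset.univ.filter fun j => z i < z j).card < k := by
  have : ∀ j, (z i < z j ∨ z j = z i ∧ j < i) ↔ z i < z j := fun j =>
    ⟨fun h => h.elim id fun h => ((hz h.1).not_lt h.2).elim, Or.inl⟩
  simp [topK, this]

theorem lt_of_mem_topK_of_notMem {n k : ℕ} {z : Fin n → ℝ} (hz : Function.Injective z)
    {i j : Fin n} (hi : i ∈ topK k z) (hj : j ∉ topK k z) : z j < z i := by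
  rw [mem_topK_iff_of_injective hz] at hi hj
  by_contra! h
  refine hj (lt_of_le_of_lt (Finset.card_le_card fun l hl => ?_) hi)
  simp only [Finset.mem_filter, Finset.mem_univ, true_and] at hl ⊢
  exact h.trans_lt hl

theorem card_topK {n k : ℕ} {z : Fin n → ℝ} (hz : Function.Injective z) (hk : k ≤ n) :
    (topK k z).card = k := by
  -- The rank: without ties it is a bijection onto `0, …, n - 1`, and `topK` is the preimage of the
  -- first `k` values.
  let r : Fin n → ℕ := fun i => (Finset.univ.filter fun j => z i < z j).card
  have hlt : ∀ i j, z i < z j → r j < r i := by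
    intro i j hij
    refine Finset.card_lt_card ⟨fun l hl => ?_, fun hsub => ?_⟩
    · simp only [Finset.mem_filter, Finset.mem_univ, true_and] at hl ⊢
      exact hij.trans hl
    · have : j ∈ Finset.univ.filter fun l => z j < z l := hsub (by simpa using hij)
      simp at this
  have hr : Function.Injective r := by
    intro i j hij
    by_contra hne
    rcases lt_or_gt_of_ne (hz.ne hne) with h | h
    · exact (hlt _ _ h).ne hij.symm
    · exact (hlt _ _ h).ne hij
  have himg : Finset.univ.image r = Finset.range n := by
    refine Finset.eq_of_subset_of_card_le (fun m hm => ?_) ?_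
    · obtain ⟨i, -, rfl⟩ := Finset.mem_image.mp hm
      rw [Finset.mem_range]
      calc r i < (Finset.univ : Finset (Fin n)).card :=
            Finset.card_lt_card ⟨Finset.subset_univ _, fun h => by simpa using h (Finset.mem_univ i)⟩
        _ = n := by simp
    · rw [Finset.card_image_of_injective _ hr]
      simp
  have : (topK k z).image r = Finset.range k := by
    ext m
    simp only [Finset.mem_image, mem_topK_iff_of_injective hz, Finset.mem_range]
    constructor
    · rintro ⟨i, hi, rfl⟩
      exact hi
    · intro hm
      obtain ⟨i, -, rfl⟩ := Finset.mem_image.mp (himg ▸ Finset.mem_range.mpr (hm.trans_le hk))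
      exact ⟨i, hm, rfl⟩
  rw [← Finset.card_image_of_injective _ hr, this, Finset.card_range]

theorem isOpen_setOf_forall_score_lt {d n : ℕ} (W : Fin n → Fin d → ℝ) (b : Fin n → ℝ)
    (S : Set (Fin n × Fin n)) : IsOpen {x | ∀ p ∈ S, score W b x p.2 < score W b x p.1} := by
  have : {x | ∀ p ∈ S, score W b x p.2 < score W b x p.1} =
      ⋂ p : S, {x | score W b x p.1.2 < score W b x p.1.1} := by
    ext x
    simp
  rw [this]
  exact isOpen_iInter_of_finite fun p =>
    isOpen_lt ((continuous_apply p.1.2).comp (continuous_score W b))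
      ((continuous_apply p.1.1).comp (continuous_score W b))

theorem eventually_topK_score_eq {d n k : ℕ} {W : Fin n → Fin d → ℝ} {b : Fin n → ℝ} (hk : k ≤ n)
    {x : Fin d → ℝ} (hx : x ∈ tieFree W b) :
    ∀ᶠ y in 𝓝 x, topK k (score W b y) = topK k (score W b x) := by
  have := (isOpen_setOf_forall_score_lt W b
    {p | p.1 ∈ topK k (score W b x) ∧ p.2 ∉ topK k (score W b x)}).mem_nhds
    (x := x) (fun p hp => lt_of_mem_topK_of_notMem hx hp.1 hp.2)
  filter_upwards [this] with y hy
  exact topK_eq_of_forall_lt (card_topK hx hk) fun i hi j hj => hy (i, j) ⟨hi, hj⟩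

theorem RealizesDifferences.exists_score_eq {d n : ℕ} {W : Fin n → Fin d → ℝ}
    (hW : RealizesDifferences W) (b z : Fin n → ℝ) :
    ∃ (x : Fin d → ℝ) (c : ℝ), ∀ i, score W b x i = z i + c := by
  obtain ⟨x, c, h⟩ := hW fun i => z i - b i
  exact ⟨x, c, fun i => by simp only [score, h]; ring⟩

/-! ### Local identification -/

theorem sum_sum_smul_sub_eq_zero {ι κ F : Type*} [AddCommGroup F] [Module ℝ F] {T : Finset ι}
    {T' : Finset κ} {e : ι → ℝ} {e' : κ → ℝ} (he : ∑ i ∈ T, e i ≠ 0) (he' : ∑ j ∈ T', e' j ≠ 0)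
    {A : ι → F} {B : κ → F}
    (h : ∑ i ∈ T, (e i / ∑ l ∈ T, e l) • A i = ∑ j ∈ T', (e' j / ∑ l ∈ T', e' l) • B j) :
    ∑ i ∈ T, ∑ j ∈ T', (e i * e' j) • (A i - B j) = 0 := by
  have hA : ∑ i ∈ T, e i • A i = (∑ l ∈ T, e l) • ∑ i ∈ T, (e i / ∑ l ∈ T, e l) • A i := by
    rw [Finset.smul_sum]
    refine Finset.sum_congr rfl fun i _ => ?_
    rw [smul_smul, mul_div_cancel₀ _ he]
  have hB : ∑ j ∈ T', e' j • B j =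
      (∑ l ∈ T', e' l) • ∑ j ∈ T', (e' j / ∑ l ∈ T', e' l) • B j := by
    rw [Finset.smul_sum]
    refine Finset.sum_congr rfl fun i _ => ?_
    rw [smul_smul, mul_div_cancel₀ _ he']
  have h1 : ∑ i ∈ T, ∑ j ∈ T', (e i * e' j) • A i = (∑ j ∈ T', e' j) • ∑ i ∈ T, e i • A i := by
    rw [Finset.smul_sum]
    refine Finset.sum_congr rfl fun i _ => ?_
    rw [← Finset.sum_smul, ← Finset.mul_sum, smul_smul, mul_comm]
  have h2 : ∑ i ∈ T, ∑ j ∈ T', (e i * e' j) • B j = (∑ i ∈ T, e i) • ∑ j ∈ T', e' j • B j := by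
    rw [Finset.sum_smul]
    refine Finset.sum_congr rfl fun i _ => ?_
    rw [Finset.smul_sum]
    exact Finset.sum_congr rfl fun j _ => mul_smul _ _ _
  simp only [smul_sub, Finset.sum_sub_distrib]
  rw [h1, h2, hA, hB, h, smul_smul, smul_smul, mul_comm, sub_self]

variable {d k n n' : ℕ} {hidden : List ℕ}

/-- The hypotheses of the identification theorem on a single mixture of experts. -/
structure Param.Nondegenerate (φ : Param d hidden n) : Prop where
  stronglyDistinct : Pairwise fun i j => StronglyDistinct (expert (φ.θ i)) (expert (φ.θ j))
  realizes : RealizesDifferences φ.W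

/-- The tie-free inputs at which all experts are locally affine. -/
def Param.regularSet (φ : Param d hidden n) : Set (Fin d → ℝ) :=
  tieFree φ.W φ.b ∩ ⋂ i, {x | LocallyAffineAt (expert (φ.θ i)) x}

/-- The set of active experts. -/
noncomputable abbrev Param.active (k : ℕ) (φ : Param d hidden n) (x : Fin d → ℝ) : Finset (Fin n) :=
  topK k (score φ.W φ.b x)

theorem Param.isOpen_regularSet (φ : Param d hidden n) : IsOpen φ.regularSet :=
  (isOpen_tieFree _ _).inter (isOpen_iInter_of_finite fun _ => isOpen_setOf_locallyAffineAt _)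

theorem Param.Nondegenerate.dense_regularSet {φ : Param d hidden n} (hφ : φ.Nondegenerate) :
    Dense φ.regularSet :=
  (dense_tieFree hφ.realizes.injective _).inter_of_isOpen_left
    (dense_iInter_of_isOpen (fun _ => isOpen_setOf_locallyAffineAt _)
      fun i => dense_setOf_locallyAffineAt_expert (φ.θ i)) (isOpen_tieFree _ _)

theorem Param.Nondegenerate.dense_inter_regularSet {φ : Param d hidden n} {φ' : Param d hidden n'}
    (hφ : φ.Nondegenerate) (hφ' : φ'.Nondegenerate) : Dense (φ.regularSet ∩ φ'.regularSet) :=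
  hφ.dense_regularSet.inter_of_isOpen_left hφ'.dense_regularSet φ.isOpen_regularSet

/-- At `x`, the active experts of `φ'` are those of `φ` with gating parameters shifted by
`(c, γ)` and the same values. -/
def AlignedAt (k : ℕ) (φ : Param d hidden n) (φ' : Param d hidden n') (x c : Fin d → ℝ)
    (γ : ℝ) : Prop :=
  (∀ i ∈ φ.active k x, ∃ j ∈ φ'.active k x, φ'.W j = φ.W i + c ∧ φ'.b j = φ.b i + γ ∧
    expert (φ'.θ j) x = expert (φ.θ i) x) ∧
  ∀ j ∈ φ'.active k x, ∃ i ∈ φ.active k x, φ'.W j = φ.W i + c ∧ φ'.b j = φ.b i + γ ∧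
    expert (φ'.θ j) x = expert (φ.θ i) x

theorem Param.Nondegenerate.injective_germ {φ : Param d hidden n} (hφ : φ.Nondegenerate)
    {x : Fin d → ℝ} {A : Fin n → (Fin d → ℝ) → Fin d → ℝ}
    (hA : ∀ i, ∀ᶠ y in 𝓝 x, expert (φ.θ i) y = A i y) : Function.Injective A := by
  intro i j hij
  by_contra hne
  have h : ∀ᶠ y in 𝓝 x, ¬ expert (φ.θ i) y ≠ expert (φ.θ j) y := by
    filter_upwards [hA i, hA j] with y hi hj
    rw [hi, hj, hij]
    exact fun h => h rfl
  exact (mem_closure_iff_frequently.mp (hφ.stronglyDistinct hne x)) h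

theorem exists_alignedAt {φ : Param d hidden n} {φ' : Param d hidden n'} (hk : 1 < k)
    (hn : k ≤ n) (hn' : k ≤ n') (hφ : φ.Nondegenerate) (hφ' : φ'.Nondegenerate)
    (hS : smoe k φ = smoe k φ') {x : Fin d → ℝ} (hx : x ∈ φ.regularSet ∩ φ'.regularSet) :
    ∃ c γ, AlignedAt k φ φ' x c γ := by
  obtain ⟨⟨hxt, hxa⟩, hxt', hxa'⟩ := hx
  choose A hA hAe using fun i => Set.mem_iInter.mp hxa i
  choose B hB hBe using fun i => Set.mem_iInter.mp hxa' i
  have hcT : (φ.active k x).card = k := card_topK hxt hn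
  have hcT' : (φ'.active k x).card = k := card_topK hxt' hn'
  have hT : (φ.active k x).Nonempty := Finset.card_pos.mp (by omega)
  have hT' : (φ'.active k x).Nonempty := Finset.card_pos.mp (by omega)
  have := hT.to_subtype
  obtain ⟨f, c, γ, hf⟩ := exists_equiv_of_sum_exp_eq_zero
    (ι := φ.active k x) (κ := φ'.active k x) (x := x)
    (by rw [Fintype.card_coe, Fintype.card_coe, hcT, hcT'])
    (hφ.realizes.comp Subtype.val_injective)
    (hφ'.realizes.injective.comp Subtype.val_injective) (φ.b ∘ Subtype.val) (φ'.b ∘ Subtype.val)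
    (A := A ∘ Subtype.val) (B := B ∘ Subtype.val) (fun i => hA i) (fun j => hB j)
    ((hφ.injective_germ hAe).comp Subtype.val_injective)
    ((hφ'.injective_germ hBe).comp Subtype.val_injective) (by
      filter_upwards [eventually_topK_score_eq hn hxt, eventually_topK_score_eq hn' hxt',
        eventually_all.mpr hAe, eventually_all.mpr hBe] with y hy hy' hyA hyB
      have h := congrFun hS y
      simp only [smoe, softmax, hy, hy', hyA, hyB] at h
      have := sum_sum_smul_sub_eq_zero
        (Finset.sum_pos (fun i _ => Real.exp_pos _) hT).ne'
        (Finset.sum_pos (fun i _ => Real.exp_pos _) hT').ne' h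
      rw [← this, ← Finset.sum_coe_sort (φ.active k x)]
      refine Finset.sum_congr rfl fun i _ => ?_
      rw [← Finset.sum_coe_sort (φ'.active k x)]
      rfl)
  have hexp : ∀ i, expert (φ'.θ (f i)) x = expert (φ.θ i) x := fun i => by
    rw [(hAe i).self_of_nhds, (hBe (f i)).self_of_nhds]
    exact (congrFun (hf i).2.2 x).symm
  refine ⟨c, γ, fun i hi => ⟨f ⟨i, hi⟩, (f ⟨i, hi⟩).2, (hf ⟨i, hi⟩).1, (hf ⟨i, hi⟩).2.1,
    hexp ⟨i, hi⟩⟩, fun j hj => ?_⟩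
  obtain ⟨i, hi⟩ := f.surjective ⟨j, hj⟩
  refine ⟨i, i.2, ?_⟩
  have h1 := hf i
  have h2 := hexp i
  rw [hi] at h1 h2
  exact ⟨h1.1, h1.2.1, h2⟩

/-! ### The shift does not depend on the active set -/

/-- The difference `W i - W l` is unaffected by the shift and determines the ordered pair of
matching indices in `φ'`; so `i` has the same partner at both inputs. -/
theorem AlignedAt.eq_of_two_mem {φ : Param d hidden n} {φ' : Param d hidden n'}
    (hφ : φ.Nondegenerate) (hφ' : φ'.Nondegenerate) {x y c c' : Fin d → ℝ} {γ γ' : ℝ}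
    (hx : AlignedAt k φ φ' x c γ) (hy : AlignedAt k φ φ' y c' γ') {i l : Fin n} (hil : i ≠ l)
    (hix : i ∈ φ.active k x) (hlx : l ∈ φ.active k x) (hiy : i ∈ φ.active k y)
    (hly : l ∈ φ.active k y) : c = c' ∧ γ = γ' := by
  obtain ⟨p, -, hp, hpb, -⟩ := hx.1 i hix
  obtain ⟨q, -, hq, -⟩ := hx.1 l hlx
  obtain ⟨r, -, hr, hrb, -⟩ := hy.1 i hiy
  obtain ⟨s, -, hs, -⟩ := hy.1 l hly
  have hpq : p ≠ q := by
    rintro rfl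
    exact hil (hφ.realizes.injective (add_right_cancel (hp.symm.trans hq)))
  have := (hφ'.realizes.eq_of_sub_eq_sub hpq (p := r) (q := s)
    (by rw [hp, hq, hr, hs, add_sub_add_right_eq_sub, add_sub_add_right_eq_sub])).1
  subst this
  exact ⟨add_left_cancel (hp.symm.trans hr), add_left_cancel (hpb.symm.trans hrb)⟩

/-- A closed half-space containing an open half-space has a proportional normal vector. -/
theorem exists_nonneg_smul_of_halfSpace {u g : Fin d → ℝ} (hu : u ≠ 0)
    (h : ∀ v, 0 < u ⬝ᵥ v → 0 ≤ g ⬝ᵥ v) : ∃ r : ℝ, 0 ≤ r ∧ g = r • u := by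
  have huu : 0 < u ⬝ᵥ u :=
    lt_of_le_of_ne (Finset.sum_nonneg fun i _ => mul_self_nonneg (u i))
      fun h0 => hu (dotProduct_self_eq_zero.mp h0.symm)
  have hgu := h u huu
  refine ⟨(g ⬝ᵥ u) / (u ⬝ᵥ u), div_nonneg hgu huu.le, ?_⟩
  set w := g - ((g ⬝ᵥ u) / (u ⬝ᵥ u)) • u with hw
  have huw : u ⬝ᵥ w = 0 := by
    rw [hw, dotProduct_sub, dotProduct_smul, smul_eq_mul, div_mul_cancel₀ _ huu.ne',
      dotProduct_comm, sub_self]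
  have hgw : g ⬝ᵥ w = w ⬝ᵥ w := by
    have : g = w + ((g ⬝ᵥ u) / (u ⬝ᵥ u)) • u := by rw [hw]; abel
    conv_lhs => rw [this]
    rw [add_dotProduct, smul_dotProduct, huw, smul_zero, add_zero]
  have hww : 0 ≤ w ⬝ᵥ w := Finset.sum_nonneg fun i _ => mul_self_nonneg (w i)
  have hpos : ∀ ε : ℝ, 0 < ε → w ⬝ᵥ w ≤ ε * (g ⬝ᵥ u) := by
    intro ε hε
    -- `w` is the part of `g` orthogonal to `u`; this test vector lies barely inside the half-space
    -- and points against `w`.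
    have := h (ε • u - w) (by
      rw [dotProduct_sub, dotProduct_smul, huw, sub_zero]
      exact mul_pos hε huu)
    rw [dotProduct_sub, dotProduct_smul, hgw, smul_eq_mul] at this
    linarith
  have hzero : w ⬝ᵥ w = 0 := by
    by_contra hne
    have hlt : 0 < w ⬝ᵥ w := lt_of_le_of_ne hww (Ne.symm hne)
    have := hpos (w ⬝ᵥ w / (g ⬝ᵥ u + 1)) (by positivity)
    rw [div_mul_eq_mul_div, le_div_iff₀ (by positivity)] at this
    nlinarith
  exact sub_eq_zero.mp (dotProduct_self_eq_zero.mp hzero)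

/-- If the active sets `insert j A` and `insert l A` of one mixture are translated to `T'` and
`S'`, and crossing from one to the other is governed by the same hyperplane in both mixtures, then
the two translations agree. -/
theorem translation_eq_of_adjacent {W : Fin n → Fin d → ℝ} {W' : Fin n' → Fin d → ℝ}
    (hW : RealizesDifferences W) (hW' : RealizesDifferences W') {A : Finset (Fin n)}
    {j l : Fin n} (hjl : j ≠ l) (hj : j ∉ A) (hl : l ∉ A) (hA : A.Nonempty)
    {T' S' : Finset (Fin n')} (hcard : T'.card = S'.card) {c₁ c₂ : Fin d → ℝ}
    (hT : ∀ p ∈ insert j A, ∃ q ∈ T', W' q = W p + c₁)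
    (hT' : ∀ q ∈ T', ∃ p ∈ insert j A, W' q = W p + c₁)
    (hS' : ∀ q ∈ S', ∃ p ∈ insert l A, W' q = W p + c₂)
    (hcross : ∀ q ∈ T', q ∉ S' → ∀ r ∈ S', r ∉ T' →
      ∃ t : ℝ, 0 ≤ t ∧ W' q - W' r = t • (W j - W l)) : c₁ = c₂ := by
  classical
  obtain ⟨a, ha⟩ := hA
  have haj : a ≠ j := fun h => hj (h ▸ ha)
  obtain ⟨q₀, hq₀, hq₀j⟩ := hT j (Finset.mem_insert_self _ _)
  obtain ⟨q₁, hq₁, hq₁a⟩ := hT a (Finset.mem_insert_of_mem ha)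
  have hq₀₁ : q₀ ≠ q₁ := by
    rintro rfl
    exact haj (hW.injective (add_right_cancel (hq₁a.symm.trans hq₀j)))
  have hSj : ∀ p ∈ insert l A, p ≠ j := by
    rintro p hp rfl
    exact (Finset.mem_insert.mp hp).elim hjl hj
  -- If `T' ⊆ S'`, the images of `j` and `a` would also be shifts by `c₂` of members of `insert l
  -- A`, and equality of differences would force `j = a`.
  by_cases hsub : T' ⊆ S'
  · obtain ⟨p, hp, hpe⟩ := hS' q₀ (hsub hq₀)
    obtain ⟨p', hp', hpe'⟩ := hS' q₁ (hsub hq₁)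
    have h : W p - W j = W p' - W a := by
      have h1 : W j + c₁ = W p + c₂ := hq₀j.symm.trans hpe
      have h2 : W a + c₁ = W p' + c₂ := hq₁a.symm.trans hpe'
      have h3 : W p - W j = c₁ - c₂ := by
        rw [sub_eq_sub_iff_add_eq_add, ← h1, add_comm]
      rw [h3, eq_comm, sub_eq_sub_iff_add_eq_add, ← h2, add_comm]
    exact (haj (hW.eq_of_sub_eq_sub (hSj p hp) h).2.symm).elim
  obtain ⟨q, hqT, hqS⟩ := Finset.not_subset.mp hsub
  obtain ⟨r, hrS, hrT⟩ : ∃ r ∈ S', r ∉ T' := by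
    refine Finset.not_subset.mp fun h => hsub ?_
    rw [Finset.eq_of_subset_of_card_le h hcard.le]
  -- Were the sets disjoint, `W' q₀ - W' r` and `W' q₁ - W' r` would both be multiples of `W j - W
  -- l`, against affine independence.
  obtain ⟨e, heT, heS⟩ : ∃ e ∈ T', e ∈ S' := by
    by_contra! hdis
    obtain ⟨t₀, -, ht₀⟩ := hcross q₀ hq₀ (hdis q₀ hq₀) r hrS hrT
    obtain ⟨t₁, -, ht₁⟩ := hcross q₁ hq₁ (hdis q₁ hq₁) r hrS hrT
    have h : t₁ • (W' q₀ - W' r) = t₀ • (W' q₁ - W' r) := by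
      rw [ht₀, ht₁, smul_smul, smul_smul, mul_comm]
    have hrq₀ : r ≠ q₀ := fun h => hrT (h ▸ hq₀)
    obtain ⟨v, κ, hv⟩ := hW' (Pi.single q₀ 1)
    have h' := congrArg (· ⬝ᵥ v) h
    simp [sub_dotProduct, hv, hrq₀, hq₀₁.symm] at h'
    rw [h', zero_smul, sub_eq_zero] at ht₁
    exact hrT (hW'.injective ht₁ ▸ hq₁)
  obtain ⟨t, ht, hqr⟩ := hcross q hqT hqS r hrS hrT
  obtain ⟨p, hp, hep⟩ := hT' e heT
  obtain ⟨p', hp', hep'⟩ := hS' e heS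
  obtain ⟨p₁, hp₁, hqp₁⟩ := hT' q hqT
  obtain ⟨p₂, hp₂, hrp₂⟩ := hS' r hrS
  have hpp₁ : p₁ ≠ p := by
    rintro rfl
    exact hqS (hW'.injective (hqp₁.trans hep.symm) ▸ heS)
  have hpp' : W p + c₁ = W p' + c₂ := hep.symm.trans hep'
  have hc : c₁ = W p' + c₂ - W p := by rw [← hpp']; abel
  have hlin : W p₁ - W p₂ + W p' - W p = t • (W j - W l) := by
    rw [← hqr, hqp₁, hrp₂, hc]
    abel
  obtain ⟨v, κ, hv⟩ := hW (Pi.single p 1)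
  have hdot := congrArg (· ⬝ᵥ v) hlin
  simp only [sub_dotProduct, add_dotProduct, smul_dotProduct, hv, Pi.single_apply, smul_eq_mul,
    if_neg hpp₁, if_true] at hdot
  have hp₂j := hSj p₂ hp₂
  have hp'j := hSj p' hp'
  -- Otherwise the coefficient of `W p` is negative on the left of `hlin`, but on the right it is `t
  -- ≥ 0` if `p = j` and zero if `p ∈ A`. The sign of `t` is essential here.
  have heq : p' = p := by
    by_contra hne
    rw [if_neg hne] at hdot
    rcases Finset.mem_insert.mp hp with rfl | hpA
    · simp only [if_neg hp₂j, if_true, if_neg hjl.symm] at hdot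
      linarith
    · have h1 : j ≠ p := fun h => hj (h ▸ hpA)
      have h2 : l ≠ p := fun h => hl (h ▸ hpA)
      simp only [if_neg h1, if_neg h2] at hdot
      split_ifs at hdot <;> linarith
  rw [heq] at hpp'
  exact add_left_cancel hpp'

/-- Every set of `k` experts is active on a nonempty open set. -/
theorem exists_active_eq {φ : Param d hidden n} (hφ : φ.Nondegenerate) {D : Set (Fin d → ℝ)}
    (hD : Dense D) {T : Finset (Fin n)} (hT : T.card = k) : ∃ x ∈ D, φ.active k x = T := by
  classical
  obtain ⟨x₀, c, hx₀⟩ := hφ.realizes.exists_score_eq φ.b fun i => if i ∈ T then 1 else 0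
  obtain ⟨x, hx, hxD⟩ := hD.inter_open_nonempty _
    (isOpen_setOf_forall_score_lt φ.W φ.b {p | p.1 ∈ T ∧ p.2 ∉ T})
    ⟨x₀, fun p hp => by
      have h1 : p.1 ∈ T := hp.1
      have h2 : p.2 ∉ T := hp.2
      simp [hx₀, h1, h2]⟩
  exact ⟨x, hxD, topK_eq_of_forall_lt hT fun i hi j hj => hx (i, j) ⟨hi, hj⟩⟩

theorem active_eq_of_active_eq {φ : Param d hidden n} {φ' : Param d hidden n'} (hk : 1 < k)
    (hn : k ≤ n) (hφ : φ.Nondegenerate) (hφ' : φ'.Nondegenerate) {x y c c' : Fin d → ℝ} {γ γ' : ℝ}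
    (hxt : x ∈ tieFree φ.W φ.b)
    (hx : AlignedAt k φ φ' x c γ) (hy : AlignedAt k φ φ' y c' γ')
    (h : φ.active k x = φ.active k y) : φ'.active k x = φ'.active k y := by
  obtain ⟨i, hi, l, hl, hil⟩ := Finset.one_lt_card.mp
    (hk.trans_eq (card_topK hxt hn).symm : 1 < (φ.active k x).card)
  obtain ⟨rfl, rfl⟩ := hx.eq_of_two_mem hφ hφ' hy hil hi hl (h ▸ hi) (h ▸ hl)
  ext j
  constructor
  · intro hj
    obtain ⟨p, hp, hpj, -⟩ := hx.2 j hj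
    obtain ⟨q, hq, hqp, -⟩ := hy.1 p (h ▸ hp)
    rwa [hφ'.realizes.injective (hpj.trans hqp.symm)]
  · intro hj
    obtain ⟨p, hp, hpj, -⟩ := hy.2 j hj
    obtain ⟨q, hq, hqp, -⟩ := hx.1 p (h.symm ▸ hp)
    rwa [hφ'.realizes.injective (hpj.trans hqp.symm)]

/-- An inequality between scores that holds on a dense part of an open set holds on all of it. -/
theorem score_le_of_dense {W : Fin n → Fin d → ℝ} {b : Fin n → ℝ} {D U : Set (Fin d → ℝ)}
    (hD : Dense D) (hU : IsOpen U) {q r : Fin n}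
    (h : ∀ y ∈ U ∩ D, score W b y r ≤ score W b y q) : ∀ y ∈ U, score W b y r ≤ score W b y q :=
  fun _ hy => closure_minimal h
    (isClosed_le ((continuous_apply r).comp (continuous_score W b))
      ((continuous_apply q).comp (continuous_score W b))) (hD.open_subset_closure_inter hU hy)

/-- Where the active set changes from `insert j A` to `insert l A`, all score comparisons of `φ'`
that change are governed by the hyperplane on which the scores `j` and `l` of `φ` agree. -/
theorem exists_crossing {φ : Param d hidden n} {φ' : Param d hidden n'}
    (hφ : φ.Nondegenerate) {A : Finset (Fin n)} {j l : Fin n}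
    (hjl : j ≠ l) (hj : j ∉ A) (hl : l ∉ A) (hAk : A.card + 1 = k) {D : Set (Fin d → ℝ)}
    (hD : Dense D) (hDt : D ⊆ tieFree φ'.W φ'.b) {T' S' : Finset (Fin n')}
    (hT' : ∀ y ∈ D, φ.active k y = insert j A → φ'.active k y = T')
    (hS' : ∀ y ∈ D, φ.active k y = insert l A → φ'.active k y = S')
    {q r : Fin n'} (hqT : q ∈ T') (hqS : q ∉ S') (hrS : r ∈ S') (hrT : r ∉ T') :
    ∃ t : ℝ, 0 ≤ t ∧ φ'.W q - φ'.W r = t • (φ.W j - φ.W l) := by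
  classical
  -- At `x₀` the indices in `A` lead, `j` and `l` tie for the last place, and all others trail;
  -- nearby, only the comparison of `j` with `l` decides the active set.
  obtain ⟨x₀, κ, hx₀⟩ := hφ.realizes.exists_score_eq φ.b
    fun i => if i ∈ A then 2 else if i = j ∨ i = l then 1 else 0
  let N := {x | ∀ p ∈ ({p | (p.1 ∈ A ∧ p.2 ∉ A) ∨ ((p.1 = j ∨ p.1 = l) ∧
    ¬ (p.2 ∈ A ∨ p.2 = j ∨ p.2 = l))} : Set (Fin n × Fin n)),
      score φ.W φ.b x p.2 < score φ.W φ.b x p.1}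
  have hN : IsOpen N := isOpen_setOf_forall_score_lt φ.W φ.b _
  have hx₀N : x₀ ∈ N := by
    rintro ⟨p, q⟩ (⟨hp, hq⟩ | ⟨hp, hq⟩)
    · simp only at hp hq
      simp only [hx₀, if_pos hp, if_neg hq]
      split_ifs <;> linarith
    · simp only at hp hq
      push Not at hq
      have hpA : p ∉ A := by rcases hp with rfl | rfl <;> assumption
      simp [hx₀, hp, hpA, hq]
  have hactive : ∀ a b, a ∉ A → (a = j ∧ b = l ∨ a = l ∧ b = j) → ∀ y ∈ N,
      score φ.W φ.b y b < score φ.W φ.b y a → φ.active k y = insert a A := by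
    intro a b haA hab y hy hlt
    refine topK_eq_of_forall_lt (by rw [Finset.card_insert_of_notMem haA, hAk]) fun p hp s hs => ?_
    simp only [Finset.mem_insert, not_or] at hp hs
    rcases hp with rfl | hp
    · by_cases hsb : s = b
      · rwa [hsb]
      · exact hy (p, s) (Or.inr ⟨by grind, by grind⟩)
    · exact hy (p, s) (Or.inl ⟨hp, hs.2⟩)
  have hside : ∀ a b, a ∉ A → (a = j ∧ b = l ∨ a = l ∧ b = j) → ∀ U' : Finset (Fin n'),
      (∀ y ∈ D, φ.active k y = insert a A → φ'.active k y = U') → ∀ q ∈ U', ∀ r ∉ U',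
      ∀ y ∈ N, score φ.W φ.b y b < score φ.W φ.b y a →
        score φ'.W φ'.b y r ≤ score φ'.W φ'.b y q := by
    intro a b haA hab U' hU' q hq r hr y hy hlt
    refine score_le_of_dense hD (hN.inter (isOpen_lt
      ((continuous_apply b).comp (continuous_score φ.W φ.b))
      ((continuous_apply a).comp (continuous_score φ.W φ.b)))) ?_ y ⟨hy, hlt⟩
    rintro z ⟨⟨hzN, hzlt⟩, hzD⟩
    have hz := hU' z hzD (hactive a b haA hab z hzN hzlt)
    rw [← hz] at hq hr
    exact (lt_of_mem_topK_of_notMem (hDt hzD) hq hr).le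
  refine exists_nonneg_smul_of_halfSpace (sub_ne_zero.mpr (hφ.realizes.injective.ne hjl)) ?_
  intro v hv
  have hnear : ∀ w : Fin d → ℝ, ∀ᶠ t : ℝ in 𝓝[>] 0, x₀ + t • w ∈ N := by
    intro w
    have hc : Continuous fun t : ℝ => x₀ + t • w := by fun_prop
    refine (hc.tendsto 0).mono_left nhdsWithin_le_nhds (hN.mem_nhds ?_)
    simpa using hx₀N
  -- The points `x₀ + t • v` and `x₀ - t • v` lie on opposite sides of the tie; adding the two
  -- resulting inequalities cancels the scores at `x₀`.
  obtain ⟨t, ⟨ht₁, ht₂⟩, ht⟩ :=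
    (((hnear v).and (hnear (-v))).and self_mem_nhdsWithin).exists
  have ht : 0 < t := ht
  rw [sub_dotProduct, sub_pos] at hv
  have hjl₀ : score φ.W φ.b x₀ j = score φ.W φ.b x₀ l := by simp [hx₀, hj, hl]
  have htv := mul_lt_mul_of_pos_left hv ht
  have h₁ := hside j l hj (Or.inl ⟨rfl, rfl⟩) T' hT' q hqT r hrT _ ht₁ (by
    rw [score_add_smul, score_add_smul]
    linarith)
  have h₂ := hside l j hl (Or.inr ⟨rfl, rfl⟩) S' hS' r hrS q hqS _ ht₂ (by
    rw [score_add_smul, score_add_smul, dotProduct_neg, dotProduct_neg]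
    linarith)
  rw [score_add_smul, score_add_smul] at h₁ h₂
  rw [dotProduct_neg, dotProduct_neg] at h₂
  rw [sub_dotProduct]
  have : t * (φ'.W r ⬝ᵥ v) ≤ t * (φ'.W q ⬝ᵥ v) := by linarith
  linarith [le_of_mul_le_mul_left this ht]

section Identification

variable {φ : Param d hidden n} {φ' : Param d hidden n'}

theorem AlignedAt.eq_of_adjacent (hk : 1 < k)
    (hn : k ≤ n) (hn' : k ≤ n') (hφ : φ.Nondegenerate) (hφ' : φ'.Nondegenerate)
    (hS : smoe k φ = smoe k φ') {x y c c' : Fin d → ℝ} {γ γ' : ℝ}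
    (hx : x ∈ φ.regularSet ∩ φ'.regularSet) (hy : y ∈ φ.regularSet ∩ φ'.regularSet)
    (hxa : AlignedAt k φ φ' x c γ) (hya : AlignedAt k φ φ' y c' γ') {A : Finset (Fin n)}
    {j l : Fin n} (hjl : j ≠ l) (hj : j ∉ A) (hl : l ∉ A)
    (hxA : φ.active k x = insert j A) (hyA : φ.active k y = insert l A) : c = c' ∧ γ = γ' := by
  have hAk : A.card + 1 = k := by
    rw [← Finset.card_insert_of_notMem hj, ← hxA]
    exact card_topK hx.1.1 hn
  have hA : A.Nonempty := Finset.card_pos.mp (by omega)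
  have hc : c = c' := by
    refine translation_eq_of_adjacent hφ.realizes hφ'.realizes hjl hj hl hA
      (T' := φ'.active k x) (S' := φ'.active k y)
      ((card_topK hx.2.1 hn').trans (card_topK hy.2.1 hn').symm) ?_ ?_ ?_ ?_
    · intro p hp
      obtain ⟨q, hq, h, -⟩ := hxa.1 p (hxA ▸ hp)
      exact ⟨q, hq, h⟩
    · intro q hq
      obtain ⟨p, hp, h, -⟩ := hxa.2 q hq
      exact ⟨p, hxA ▸ hp, h⟩
    · intro q hq
      obtain ⟨p, hp, h, -⟩ := hya.2 q hq
      exact ⟨p, hyA ▸ hp, h⟩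
    · intro q hqT hqS r hrS hrT
      refine exists_crossing hφ hjl hj hl hAk (hφ.dense_inter_regularSet hφ')
        (fun z hz => hz.2.1) ?_ ?_ hqT hqS hrS hrT
      · intro z hz hzA
        obtain ⟨e, δ, he⟩ := exists_alignedAt hk hn hn' hφ hφ' hS hz
        exact active_eq_of_active_eq hk hn hφ hφ' hz.1.1 he hxa (hzA.trans hxA.symm)
      · intro z hz hzA
        obtain ⟨e, δ, he⟩ := exists_alignedAt hk hn hn' hφ hφ' hS hz
        exact active_eq_of_active_eq hk hn hφ hφ' hz.1.1 he hya (hzA.trans hyA.symm)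
  refine ⟨hc, ?_⟩
  obtain ⟨a, ha⟩ := hA
  obtain ⟨p, -, hp, hpb, -⟩ := hxa.1 a (hxA ▸ Finset.mem_insert_of_mem ha)
  obtain ⟨q, -, hq, hqb, -⟩ := hya.1 a (hyA ▸ Finset.mem_insert_of_mem ha)
  have hpq := hφ'.realizes.injective (hp.trans ((congrArg _ hc).trans hq.symm))
  exact add_left_cancel (hpb.symm.trans ((congrArg _ hpq).trans hqb))

theorem AlignedAt.shift_unique (hk : 1 < k)
    (hn : k ≤ n) (hn' : k ≤ n') (hφ : φ.Nondegenerate) (hφ' : φ'.Nondegenerate)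
    (hS : smoe k φ = smoe k φ') {x y c c' : Fin d → ℝ} {γ γ' : ℝ}
    (hx : x ∈ φ.regularSet ∩ φ'.regularSet) (hy : y ∈ φ.regularSet ∩ φ'.regularSet)
    (hxa : AlignedAt k φ φ' x c γ) (hya : AlignedAt k φ φ' y c' γ') : c = c' ∧ γ = γ' := by
  classical
  have hcy : (φ.active k y).card = k := card_topK hy.1.1 hn
  obtain ⟨m, hm⟩ : ∃ m, (φ.active k x \ φ.active k y).card = m := ⟨_, rfl⟩
  induction m generalizing x c γ with
  | zero =>
    have hcx : (φ.active k x).card = k := card_topK hx.1.1 hn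
    have hsub := Finset.sdiff_eq_empty_iff_subset.mp (Finset.card_eq_zero.mp hm)
    obtain ⟨i, hi, l, hl, hil⟩ := Finset.one_lt_card.mp (hk.trans_eq hcx.symm)
    exact hxa.eq_of_two_mem hφ hφ' hya hil hi hl (hsub hi) (hsub hl)
  | succ m ih =>
    have hcx : (φ.active k x).card = k := card_topK hx.1.1 hn
    obtain ⟨j, hj⟩ := Finset.card_pos.mp (show 0 < (φ.active k x \ φ.active k y).card by omega)
    obtain ⟨l, hl⟩ := Finset.card_pos.mp (show 0 < (φ.active k y \ φ.active k x).card by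
      rw [Finset.card_sdiff_comm (hcy.trans hcx.symm)]
      omega)
    rw [Finset.mem_sdiff] at hj hl
    have hjl : j ≠ l := fun h => hj.2 (h ▸ hl.1)
    have hlA : l ∉ (φ.active k x).erase j := fun h => hl.2 (Finset.mem_of_mem_erase h)
    -- Exchanging `j` for `l` brings the active set one step closer to that of `y`.
    obtain ⟨z, hz, hzA⟩ := exists_active_eq (k := k) hφ (hφ.dense_inter_regularSet hφ')
      (T := insert l ((φ.active k x).erase j)) (by
        rw [Finset.card_insert_of_notMem hlA, Finset.card_erase_of_mem hj.1, hcx]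
        omega)
    obtain ⟨e, δ, he⟩ := exists_alignedAt hk hn hn' hφ hφ' hS hz
    obtain ⟨rfl, rfl⟩ := hxa.eq_of_adjacent hk hn hn' hφ hφ' hS hx hz he hjl
      (Finset.notMem_erase j _) hlA (Finset.insert_erase hj.1).symm hzA
    refine ih hz he ?_
    rw [hzA, Finset.insert_sdiff_of_mem _ hl.1, Finset.erase_sdiff_comm,
      Finset.card_erase_of_mem (Finset.mem_sdiff.mpr hj), hm]
    rfl

/-! ### Global identification of gating parameters and experts. -/

/-- Equal mixtures are aligned with the same shift at all regular inputs. -/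
theorem exists_forall_alignedAt (hk : 1 < k) (hn : k ≤ n) (hn' : k ≤ n')
    (hφ : φ.Nondegenerate) (hφ' : φ'.Nondegenerate) (hS : smoe k φ = smoe k φ') :
    ∃ c γ, ∀ x ∈ φ.regularSet ∩ φ'.regularSet, AlignedAt k φ φ' x c γ := by
  obtain ⟨x₀, hx₀⟩ := (hφ.dense_inter_regularSet hφ').nonempty
  obtain ⟨c, γ, h₀⟩ := exists_alignedAt hk hn hn' hφ hφ' hS hx₀
  refine ⟨c, γ, fun x hx => ?_⟩
  obtain ⟨c', γ', h⟩ := exists_alignedAt hk hn hn' hφ hφ' hS hx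
  obtain ⟨rfl, rfl⟩ := h₀.shift_unique hk hn hn' hφ hφ' hS hx₀ hx h
  exact h

/-- Every expert is active at some input of a given dense set. -/
theorem exists_mem_active (hk : 1 < k) (hn : k ≤ n) (hφ : φ.Nondegenerate)
    {D : Set (Fin d → ℝ)} (hD : Dense D) (i : Fin n) : ∃ x ∈ D, i ∈ φ.active k x := by
  obtain ⟨T, hiT, -, hT⟩ := Finset.exists_subsuperset_card_eq (n := k)
    (Finset.subset_univ {i}) (by simp; omega) (by simpa using hn)
  obtain ⟨x, hx, hxT⟩ := exists_active_eq hφ hD hT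
  exact ⟨x, hx, hxT ▸ hiT (Finset.mem_singleton_self i)⟩

theorem exists_equiv_translate_gating (hk : 1 < k) (hn : k ≤ n) (hn' : k ≤ n')
    (hφ : φ.Nondegenerate) (hφ' : φ'.Nondegenerate) {c : Fin d → ℝ} {γ : ℝ}
    (h : ∀ x ∈ φ.regularSet ∩ φ'.regularSet, AlignedAt k φ φ' x c γ) :
    ∃ σ : Fin n ≃ Fin n', ∀ i, φ'.W (σ i) = φ.W i + c ∧ φ'.b (σ i) = φ.b i + γ := by
  have hD := hφ.dense_inter_regularSet hφ'
  have hfwd : ∀ i, ∃ j, φ'.W j = φ.W i + c ∧ φ'.b j = φ.b i + γ := by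
    intro i
    obtain ⟨x, hx, hi⟩ := exists_mem_active hk hn hφ hD i
    obtain ⟨j, -, hW, hb, -⟩ := (h x hx).1 i hi
    exact ⟨j, hW, hb⟩
  choose σ hσ using hfwd
  refine ⟨Equiv.ofBijective σ ⟨fun i l hil => ?_, fun j => ?_⟩, hσ⟩
  · refine hφ.realizes.injective (add_right_cancel ((hσ i).1.symm.trans ?_))
    rw [hil]
    exact (hσ l).1
  · obtain ⟨x, hx, hj⟩ := exists_mem_active hk hn' hφ' hD j
    obtain ⟨i, -, hW, -⟩ := (h x hx).2 j hj
    exact ⟨i, hφ'.realizes.injective ((hσ i).1.trans hW.symm)⟩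

/-- Near a tie-free `x` the active set of `φ` is constant, so the identity holds at nearby regular
points and passes to `x` by continuity; `x` may have ties for `φ'`. -/
theorem expert_eq_of_mem_active (hn : k ≤ n)
    (hφ : φ.Nondegenerate) (hφ' : φ'.Nondegenerate) {c : Fin d → ℝ} {γ : ℝ}
    (h : ∀ x ∈ φ.regularSet ∩ φ'.regularSet, AlignedAt k φ φ' x c γ) {i : Fin n} {j : Fin n'}
    (hij : φ'.W j = φ.W i + c) {x : Fin d → ℝ} (hx : x ∈ tieFree φ.W φ.b)
    (hi : i ∈ φ.active k x) : expert (φ'.θ j) x = expert (φ.θ i) x := by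
  obtain ⟨U, hUsub, hU, hxU⟩ := mem_nhds_iff.mp (eventually_topK_score_eq (k := k) hn hx)
  refine closure_minimal (s := U ∩ (φ.regularSet ∩ φ'.regularSet)) ?_
    (isClosed_eq (continuous_expert (φ'.θ j)) (continuous_expert (φ.θ i)))
    ((hφ.dense_inter_regularSet hφ').open_subset_closure_inter hU hxU)
  rintro y ⟨hyU, hy⟩
  have hyT : φ.active k y = φ.active k x := hUsub hyU
  obtain ⟨q, -, hq, -, hqe⟩ := (h y hy).1 i (hyT.symm ▸ hi)
  rw [hφ'.realizes.injective (hij.trans hq.symm)]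
  exact hqe

end Identification

end SMoE

theorem theorem4p2 (d k n n' : ℕ) (hidden : List ℕ)
    (hk : 1 < k) (hn : k ≤ n) (hn' : k ≤ n')
    (φ : SMoE.Param d hidden n) (φ' : SMoE.Param d hidden n')
    (hS : SMoE.smoe k φ = SMoE.smoe k φ')
    (hE : Pairwise fun i j =>
      SMoE.StronglyDistinct (SMoE.expert (φ.θ i)) (SMoE.expert (φ.θ j)))
    (hE' : Pairwise fun i j =>
      SMoE.StronglyDistinct (SMoE.expert (φ'.θ i)) (SMoE.expert (φ'.θ j)))
    (hW : LinearIndependent ℝ (SMoE.consecutiveDiff φ.W))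
    (hW' : LinearIndependent ℝ (SMoE.consecutiveDiff φ'.W)) :
    ∃ h : n = n', ∃ (cW : Fin d → ℝ) (cb : ℝ) (τ : Equiv.Perm (Fin n)), ∀ i : Fin n,
      φ'.W (Fin.cast h i) = φ.W (τ i) + cW ∧
      φ'.b (Fin.cast h i) = φ.b (τ i) + cb ∧
      ∀ x ∈ SMoE.tieFree φ.W φ.b, τ i ∈ SMoE.topK k (SMoE.score φ.W φ.b x) →
        SMoE.expert (φ'.θ (Fin.cast h i)) x = SMoE.expert (φ.θ (τ i)) x := by
  have hφ : φ.Nondegenerate := ⟨hE, SMoE.realizesDifferences_of_linearIndependent hW⟩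
  have hφ' : φ'.Nondegenerate := ⟨hE', SMoE.realizesDifferences_of_linearIndependent hW'⟩
  obtain ⟨c, γ, h⟩ := SMoE.exists_forall_alignedAt hk hn hn' hφ hφ' hS
  obtain ⟨σ, hσ⟩ := SMoE.exists_equiv_translate_gating hk hn hn' hφ hφ' h
  have hnn : n = n' := by simpa using Fintype.card_congr σ
  subst hnn
  refine ⟨rfl, c, γ, σ.symm, fun i => ?_⟩
  have hi := hσ (σ.symm i)
  rw [Equiv.apply_symm_apply] at hi
  exact ⟨hi.1, hi.2, fun x hx hmem => SMoE.expert_eq_of_mem_active hn hφ hφ' h hi.1 hx hmem⟩
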